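/- Setting. A corpus has $D$ documents of $N\ge 1$ words $w_{dn}\in\{1,\dots,M\}$ with responses $y_d\in\mathbb R$. Supervised LDA with $K$ topics has, for $\alpha\in(0,\infty)^K$, topics $\beta_k$ (distributions on the vocabulary) and $\delta>0$, the joint law $p(\theta,\mathbf z,\mathbf y,\mathbf W\mid\alpha,\beta,\eta,\delta^2)=\prod_d \mathrm{Dir}(\theta_d\mid\alpha)\prod_n\theta_{d,z_{dn}}\beta_{z_{dn},w_{dn}}\cdot\mathcal N(y_d\mid\eta^\top\bar z_d,\delta^2)$, where $\bar z_d=\frac1N\sum_n z_{dn}$ with $z_{dn}$ in one-hot coding. Fix $\alpha,\beta,\delta$ and a factorised $q(\theta,\mathbf z)=\prod_d\mathrm{Dir}(\theta_d\mid\gamma_d)\prod_n\mathrm{Mult}(z_{dn}\mid\phi_{dn})$, $\gamma_d\in(0,\infty)^K$, $\phi_{dn}$ a distribution on the topics, with $\beta_{k,w_{dn}}>0$ whenever $\phi_{dnk}>0$. Put $\mathcal L^s(\eta)=-E_{q(\theta,\mathbf z)}[\log p(\theta,\mathbf z,\mathbf y,\mathbf W\mid\alpha,\beta,\eta,\delta^2)]-\mathcal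 H(q(\theta,\mathbf z))$ and $\mathcal L^{bs}(q)=KL(q(\eta)\,\|\,p_0(\eta))+E_{q(\eta)}[\mathcal L^s(\eta)]$. Let $C>0$, $\epsilon\in\mathbb R$. With $q(\theta,\mathbf z)$, $\alpha,\beta,\delta$ held fixed, the problem P1 (MedLDA$^r_{full}$) is $$\min_{q(\eta),\xi,\xi^\star}\ \mathcal L^{bs}(q)+C\sum_d(\xi_d+\xi_d^\star)\quad\text{s.t. } \forall d:\ y_d-E[\eta^\top\bar Z_d]\le\epsilon+\xi_d,\ \ -y_d+E[\eta^\top\bar Z_d]\le\epsilon+\xi_d^\star,\ \ \xi_d,\xi_d^\star\ge0,$$ over all probability distributions $q(\eta)$ on $\mathbb R^K$ with a mean and $\xi,\xi^\star\in\mathbb R^D$. Let $\mu,\mu^\star,v,v^\star$ be the multipliers of the four families of constraints, let the dual function be the infimum of the Lagrangian over $(q(\eta),\xi,\xi^\star)$, and let the dual problem be its maximisation over non-negative multipliers. Let $A$ be the $D\times K$ matrix with rows $\bar Z_d^\top$. Claim. Let $p_0(\eta)=\mathcal N(0,I)$ and $$\Sigma=\Big(I+\tfrac1{\delta^2}E[A^\top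 A]\Big)^{-1},\qquad a=a(\mu,\mu^\star)=\sum_{d=1}^D\Big(\mu_d-\mu_d^\star+\frac{y_d}{\delta^2}\Big)E[\bar Z_d],\qquad \lambda=\Sigma a .$$ Then $\Sigma$ is positive definite, and: (1) for any multipliers, $\mathcal N(\lambda,\Sigma)$ is the unique minimiser of the Lagrangian over $q(\eta)$; (2) up to an additive constant independent of the multipliers, the dual function equals $-\frac12a^\top\Sigma a-\epsilon\sum_d(\mu_d+\mu_d^\star)+\sum_dy_d(\mu_d-\mu_d^\star)$ if $\mu+v=\mu^\star+v^\star=C\mathbf 1$, and it is $-\infty$ otherwise. Hence the dual problem of P1 is the quadratic program $$\max_{\mu,\mu^\star}\ -\tfrac12a^\top\Sigma a-\epsilon\sum_{d}(\mu_d+\mu_d^\star)+\sum_{d}y_d(\mu_d-\mu_d^\star)\quad\text{s.t. }\forall d:\ \mu_d,\mu_d^\star\in[0,C]$$ (the two have the same solutions $(\mu,\mu^\star)$), and it has a solution; (3) for every solution $(\mu,\mu^\star)$ of the dual problem, $q(\eta)$ is optimal in P1 (together with some $\xi,\xi^\star$) if and only if $q(\eta)=\mathcal N(\lambda,\Sigma)$.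 -/

import Mathlib

open MeasureTheory ProbabilityTheory Matrix
open scoped NNReal ENNReal

noncomputable section

/-- The law on `ℝ^K` (carried by the probability simplex) of `(g₁, …, g_K) / ∑ gⱼ` for independent
`g_k ~ Gamma(γ_k, 1)`: the Dirichlet distribution with parameter `γ`. -/
def dirichletMeasure {K : ℕ} (γ : Fin K → ℝ) : Measure (Fin K → ℝ) :=
  (Measure.pi fun k => gammaMeasure (γ k) 1).map fun g k => g k / ∑ j, g j

/-- The Dirichlet density (in the usual coordinates of the probability simplex). -/
def dirichletPDF {K : ℕ} (γ : Fin K → ℝ) (θ : Fin K → ℝ) : ℝ :=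
  Real.Gamma (∑ k, γ k) / (∏ k, Real.Gamma (γ k)) * ∏ k, θ k ^ (γ k - 1)

/-- All quantities that are held fixed while the distribution `q(η)` and the slack variables are
optimised: a corpus of `D` documents of `N` words each over a vocabulary of `M` terms, with real
responses, the parameters of the supervised topic model with `K` topics, the variational
parameters `γ`, `φ` of the factorised distribution `q(θ, z) = ∏ Dir(θ_d | γ_d) ∏ Mult(z_dn | φ_dn)`,
the regularisation constant `C` and the precision parameter `ε`. -/
structure MedLDA (D N K M : ℕ) where
  /-- responses -/
  y : Fin D → ℝ
  /-- words -/
  w : Fin D → Fin N → Fin M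
  /-- Dirichlet parameter of the topic proportions -/
  α : Fin K → ℝ
  /-- topics: distributions over the vocabulary -/
  β : Fin K → Fin M → ℝ
  /-- standard deviation of the response -/
  δ : ℝ≥0
  /-- variational Dirichlet parameters -/
  γ : Fin D → Fin K → ℝ
  /-- variational categorical parameters -/
  φ : Fin D → Fin N → Fin K → ℝ
  /-- regularisation constant -/
  C : ℝ
  /-- precision parameter of the insensitive loss -/
  ε : ℝ
  α_pos : ∀ k, 0 < α k
  β_mem : ∀ k, β k ∈ stdSimplex ℝ (Fin M)
  δ_pos : 0 < δ
  γ_pos : ∀ d k, 0 < γ d k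
  φ_mem : ∀ d n, φ d n ∈ stdSimplex ℝ (Fin K)
  /-- the variational bound is not identically `+∞` -/
  β_pos : ∀ d n k, 0 < φ d n k → 0 < β k (w d n)
  C_pos : 0 < C

namespace MedLDA

variable {D N K M : ℕ} (P : MedLDA D N K M)

/-- Expectation of a function of the topic assignments `z` under `q(z) = ∏ φ_dn(z_dn)`. -/
def Ez {E : Type*} [AddCommMonoid E] [Module ℝ E] (f : (Fin D → Fin N → Fin K) → E) : E :=
  ∑ z : Fin D → Fin N → Fin K, (∏ d, ∏ n, P.φ d n (z d n)) • f z

/-- `z̄_d`, the average of the one-hot topic indicators of document `d`. -/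
def zbar (z : Fin D → Fin N → Fin K) (d : Fin D) : Fin K → ℝ :=
  (1 / (N : ℝ)) • ∑ n, Pi.single (z d n) 1

/-- The `D × K` matrix with rows `z̄_dᵀ`. -/
def A (z : Fin D → Fin N → Fin K) : Matrix (Fin D) (Fin K) ℝ :=
  Matrix.of fun d => zbar z d

/-- `E[Z̄_d]`. -/
def EZbar (d : Fin D) : Fin K → ℝ := P.Ez fun z => zbar z d

/-- `E[Aᵀ A]`. -/
def EAtA : Matrix (Fin K) (Fin K) ℝ := P.Ez fun z => (A z)ᵀ * A z

/-- Expected log-likelihood `E_{q(θ,z)}[log p(θ, z, y, W | α, β, η, δ²)]` for a given `η`. -/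
def expectedLogJoint (η : EuclideanSpace ℝ (Fin K)) : ℝ :=
  ∑ d, ((∫ θ, Real.log (dirichletPDF P.α θ) ∂dirichletMeasure (P.γ d))
    + ∑ n, ((∫ θ, P.Ez (fun z => Real.log (θ (z d n))) ∂dirichletMeasure (P.γ d))
      + P.Ez (fun z => Real.log (P.β (z d n) (P.w d n))))
    + P.Ez (fun z => Real.log (gaussianPDFReal (η.ofLp ⬝ᵥ zbar z d) (P.δ ^ 2) (P.y d))))

/-- The entropy of `q(θ, z)`. -/
def latentEntropy : ℝ :=
  ∑ d, (-(∫ θ, Real.log (dirichletPDF (P.γ d) θ) ∂dirichletMeasure (P.γ d))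
    + ∑ n, ∑ k, Real.negMulLog (P.φ d n k))

/-- The variational bound of supervised LDA, as a function of the regression coefficients. -/
def Ls (η : EuclideanSpace ℝ (Fin K)) : ℝ := -P.expectedLogJoint η - P.latentEntropy

/-- The variational bound `KL(q(η) ‖ p₀(η)) + E_{q(η)}[Ls]`. As `Ls` is quadratic and bounded below,
it is `q`-integrable whenever the divergence from a Gaussian prior is finite; for an infinite
divergence the bound is `⊤`. -/
def Lbs (p₀ q : Measure (EuclideanSpace ℝ (Fin K))) : EReal :=
  ((InformationTheory.klDiv q p₀ : ℝ≥0∞) : EReal) + ((∫ η, P.Ls η ∂q : ℝ) : EReal)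

/-- `E[ηᵀ Z̄_d]` under `q(η) q(z)`. -/
def pred (q : Measure (EuclideanSpace ℝ (Fin K))) (d : Fin D) : ℝ :=
  ∫ η, P.Ez (fun z => η.ofLp ⬝ᵥ zbar z d) ∂q

/-- The distributions `q(η)` over which one optimises: all probability distributions on `ℝ^K` with
a mean. -/
def Admissible (q : Measure (EuclideanSpace ℝ (Fin K))) : Prop :=
  IsProbabilityMeasure q ∧ Integrable (fun η => η) q

/-- The constraints of the primal problem. -/
def Feasible (q : Measure (EuclideanSpace ℝ (Fin K))) (ξ ξ' : Fin D → ℝ) : Prop :=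
  Admissible q ∧ ∀ d,
    P.y d - P.pred q d ≤ P.ε + ξ d ∧ -P.y d + P.pred q d ≤ P.ε + ξ' d ∧ 0 ≤ ξ d ∧ 0 ≤ ξ' d

/-- The objective of the primal problem. -/
def objective (p₀ q : Measure (EuclideanSpace ℝ (Fin K))) (ξ ξ' : Fin D → ℝ) : EReal :=
  P.Lbs p₀ q + ((P.C * ∑ d, (ξ d + ξ' d) : ℝ) : EReal)

/-- `(q, ξ, ξ')` solves the primal problem. -/
def IsOptimal (p₀ q : Measure (EuclideanSpace ℝ (Fin K))) (ξ ξ' : Fin D → ℝ) : Prop :=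
  P.Feasible q ξ ξ' ∧
    ∀ q₁ ξ₁ ξ₁', P.Feasible q₁ ξ₁ ξ₁' → P.objective p₀ q ξ ξ' ≤ P.objective p₀ q₁ ξ₁ ξ₁'

/-- The Lagrangian of the primal problem, with multipliers `μ, μ', v, v'` of the four families of
inequality constraints. -/
def lagrangian (p₀ q : Measure (EuclideanSpace ℝ (Fin K))) (ξ ξ' μ μ' v v' : Fin D → ℝ) : EReal :=
  P.objective p₀ q ξ ξ' +
    ((-(∑ d, μ d * (P.ε + ξ d - P.y d + P.pred q d))
      - (∑ d, μ' d * (P.ε + ξ' d + P.y d - P.pred q d))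
      - ∑ d, (v d * ξ d + v' d * ξ' d) : ℝ) : EReal)

/-- The Lagrange dual function: the infimum of the Lagrangian over the primal variables. -/
def dualFun (p₀ : Measure (EuclideanSpace ℝ (Fin K))) (μ μ' v v' : Fin D → ℝ) : EReal :=
  ⨅ (q : Measure (EuclideanSpace ℝ (Fin K))) (_ : Admissible q) (ξ : Fin D → ℝ) (ξ' : Fin D → ℝ),
    P.lagrangian p₀ q ξ ξ' μ μ' v v'

/-- `(μ, μ')`, completed by some `(v, v')`, solves the Lagrange dual problem: to maximise the dual
function over all non-negative multipliers. -/
def IsDualSolution (p₀ : Measure (EuclideanSpace ℝ (Fin K))) (μ μ' : Fin D → ℝ) : Prop :=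
  ∃ v v' : Fin D → ℝ, (0 ≤ μ ∧ 0 ≤ μ' ∧ 0 ≤ v ∧ 0 ≤ v') ∧
    ∀ μ₁ μ₁' v₁ v₁' : Fin D → ℝ, 0 ≤ μ₁ → 0 ≤ μ₁' → 0 ≤ v₁ → 0 ≤ v₁' →
      P.dualFun p₀ μ₁ μ₁' v₁ v₁' ≤ P.dualFun p₀ μ μ' v v'

/-- `Σ = (I + E[Aᵀ A] / δ²)⁻¹`. -/
def postCov : Matrix (Fin K) (Fin K) ℝ :=
  (1 + (1 / (P.δ : ℝ) ^ 2) • P.EAtA)⁻¹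

/-- `a = ∑_d (μ_d - μ'_d + y_d / δ²) E[Z̄_d]`. -/
def a (μ μ' : Fin D → ℝ) : Fin K → ℝ :=
  ∑ d, (μ d - μ' d + P.y d / (P.δ : ℝ) ^ 2) • P.EZbar d

/-- `Σ a`, the mean of the optimal distribution. -/
def postMean (μ μ' : Fin D → ℝ) : EuclideanSpace ℝ (Fin K) :=
  WithLp.toLp 2 (P.postCov *ᵥ P.a μ μ')

/-- The objective of the quadratic program. -/
def qpObjective (μ μ' : Fin D → ℝ) : ℝ :=
  -(1 / 2) * (P.a μ μ' ⬝ᵥ P.postCov *ᵥ P.a μ μ')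
    - P.ε * ∑ d, (μ d + μ' d) + ∑ d, P.y d * (μ d - μ' d)

/-- The box `[0, C]^D × [0, C]^D`. -/
def InBox (μ μ' : Fin D → ℝ) : Prop :=
  ∀ d, μ d ∈ Set.Icc 0 P.C ∧ μ' d ∈ Set.Icc 0 P.C

/-- `(μ, μ')` maximises the quadratic objective over the box. -/
def IsQPSolution (μ μ' : Fin D → ℝ) : Prop :=
  P.InBox μ μ' ∧ ∀ μ₁ μ₁', P.InBox μ₁ μ₁' → P.qpObjective μ₁ μ₁' ≤ P.qpObjective μ μ'

end MedLDA

end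

/-! The bound `Ls` is a convex quadratic in `η` with Hessian `H = E[AᵀA]/δ²`, and the constraints
are linear in `η`. The `q`-dependent part of the Lagrangian is therefore `KL(q ‖ p₀) - E_q[f]`, with
`f η = -½ ηᵀHη + η·a`. By the Gibbs variational principle (`klDiv_tilted_right`) this equals `KL(q ‖
p₀.tilted f) - log ∫ exp f dp₀`. Completing the square identifies the tilted measure with `N(Σa, Σ)`
(`tilted_exponent`) and shows that `a` enters the log-normaliser only through `½ aᵀΣa`
(`log_integral_exp_exponent`). So the Lagrangian is a divergence from the Gaussian, plus the
quadratic objective, a constant and a term linear in the slacks (`lagrangian_of_klDiv_ne_top`). The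
divergence vanishes only at the Gaussian, and the linear term is unbounded below unless its
coefficients are zero; this gives the minimiser and the dual function.

Strong duality needs no abstract theorem. The gradient of the quadratic program consists of the
residuals of the Gaussian's predictions, so its first-order conditions are complementary slackness
for the slacks `max g 0`, and the Gaussian attains the dual value (`IsQPSolution.exists_feasible`).
With weak duality, every primal optimum then has zero divergence from it. -/

noncomputable section

/-! ### Exponential tilting of measures -/

section Tilted

variable {α β : Type*} {mα : MeasurableSpace α} {mβ : MeasurableSpace β}

theorem map_tilted_comp (μ : Measure α) {e : α → β} (he : Measurable e) {f : β → ℝ}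
    (hf : Measurable f) : (μ.tilted (f ∘ e)).map e = (μ.map e).tilted f := by
  ext s hs
  rw [Measure.map_apply he hs, tilted_apply' _ _ (he hs), tilted_apply' _ _ hs,
    integral_map he.aemeasurable (by fun_prop), setLIntegral_map hs (by fun_prop) he]
  rfl

/-- Normalisation cancels `c`. This discards the Jacobian when Lebesgue measure is pushed through an
affine map. -/
theorem smul_measure_tilted (μ : Measure α) {c : ℝ≥0∞} (hc : c ≠ 0) (hc' : c ≠ ∞) (f : α → ℝ) :
    (c • μ).tilted f = μ.tilted f := by
  have hc₀ : 0 < c.toReal := ENNReal.toReal_pos hc hc'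
  ext s hs
  rw [tilted_apply' _ _ hs, tilted_apply' _ _ hs, integral_smul_measure, Measure.restrict_smul,
    lintegral_smul_measure, smul_eq_mul, smul_eq_mul, ← lintegral_const_mul' _ _ hc']
  refine lintegral_congr fun x => ?_
  rw [← ENNReal.ofReal_toReal hc', ← ENNReal.ofReal_mul hc₀.le, ENNReal.toReal_ofReal hc₀.le]
  congr 1
  field_simp

theorem tilted_add_const (μ : Measure α) (f : α → ℝ) (c : ℝ) :
    μ.tilted (fun x => f x + c) = μ.tilted f := by
  simp only [Measure.tilted, Real.exp_add, integral_mul_const]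
  congr 1
  ext x
  rw [mul_div_mul_right _ _ (Real.exp_pos c).ne']

end Tilted

/-! ### Kullback-Leibler divergence and tilting -/

section KullbackLeibler

open InformationTheory

variable {α : Type*} {mα : MeasurableSpace α} {μ ν : Measure α}

/-- The Fenchel-Young inequality for the entropy function. -/
theorem mul_le_klFun_add_exp {a b : ℝ} (ha : 0 ≤ a) : a * b ≤ klFun a + Real.exp b := by
  rw [klFun_apply]
  rcases ha.eq_or_lt with rfl | ha
  · simp; positivity
  -- The supremum of `a * b - exp b` over `b` is attained at `b = log a`; this is the tangent-line
  -- bound there.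
  · have h := Real.add_one_le_exp (b - Real.log a)
    rw [Real.exp_sub, Real.exp_log ha, le_div_iff₀ ha] at h
    nlinarith

/-- Fenchel-Young with `a = dμ/dν` dominates `f dμ/dν` by `klFun (dμ/dν) + exp f`, whose first term
is integrable because the divergence is finite. -/
theorem integrable_of_klDiv_ne_top [IsFiniteMeasure μ] [IsFiniteMeasure ν] (h : klDiv μ ν ≠ ∞)
    {f : α → ℝ} (hf : Measurable f) (hf₀ : ∀ x, 0 ≤ f x)
    (hexp : Integrable (fun x => Real.exp (f x)) ν) : Integrable f μ := by
  obtain ⟨hac, hllr⟩ := klDiv_ne_top_iff.1 h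
  rw [← integrable_rnDeriv_smul_iff hac]
  refine (((integrable_klFun_rnDeriv_iff hac).2 hllr).add hexp).mono'
    (Measurable.aestronglyMeasurable (by fun_prop)) (ae_of_all _ fun x => ?_)
  rw [smul_eq_mul, Real.norm_of_nonneg (mul_nonneg ENNReal.toReal_nonneg (hf₀ x))]
  exact mul_le_klFun_add_exp ENNReal.toReal_nonneg

/-- Tilting `ν` changes the log-likelihood ratio by `-f + log ∫ exp f dν`; integrate against `μ`. -/
theorem klDiv_tilted_right [IsProbabilityMeasure μ] [IsProbabilityMeasure ν]
    (h : klDiv μ ν ≠ ∞) {f : α → ℝ} (hfμ : Integrable f μ)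
    (hfν : Integrable (fun x => Real.exp (f x)) ν) :
    klDiv μ (ν.tilted f) ≠ ∞ ∧ (klDiv μ (ν.tilted f)).toReal =
      (klDiv μ ν).toReal - ∫ x, f x ∂μ + Real.log (∫ x, Real.exp (f x) ∂ν) := by
  obtain ⟨hac, hllr⟩ := klDiv_ne_top_iff.1 h
  have := isProbabilityMeasure_tilted hfν
  have hac' := hac.trans (absolutelyContinuous_tilted hfν)
  refine ⟨klDiv_ne_top hac' (integrable_llr_tilted_right hac hfμ hllr hfν), ?_⟩
  rw [toReal_klDiv_of_measure_eq hac' (by simp), toReal_klDiv_of_measure_eq hac (by simp),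
    integral_llr_tilted_right hac hfμ hfν hllr]

theorem klDiv_tilted_left_ne_top [IsProbabilityMeasure ν] {f : α → ℝ}
    (hfν : Integrable (fun x => Real.exp (f x)) ν) (hf : Integrable f (ν.tilted f)) :
    klDiv (ν.tilted f) ν ≠ ∞ := by
  have := isProbabilityMeasure_tilted hfν
  refine klDiv_ne_top (tilted_absolutelyContinuous ν f) ?_
  have h := (tilted_absolutelyContinuous ν f).ae_le (log_rnDeriv_tilted_left_self hfν)
  exact (integrable_congr h).2 (hf.sub (integrable_const _))

end KullbackLeibler

/-! ### Gaussian measures as tilts of Lebesgue measure -/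

section Gaussian

variable {E : Type*} [NormedAddCommGroup E] [InnerProductSpace ℝ E] [FiniteDimensional ℝ E]
  [MeasurableSpace E] [BorelSpace E]

theorem integrable_exp_neg_mul_sq_norm {b : ℝ} (hb : 0 < b) :
    Integrable (fun x : E => Real.exp (-b * ‖x‖ ^ 2)) := by
  have h := (GaussianFourier.integrable_cexp_neg_mul_sq_norm_add (V := E) (b := b)
    (by simpa using hb) 0 0).re
  refine h.congr (ae_of_all _ fun x => ?_)
  simp only [zero_mul, add_zero]
  rw [← Complex.ofReal_pow, ← Complex.ofReal_neg, ← Complex.ofReal_mul, ← Complex.ofReal_exp]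
  exact Complex.ofReal_re _

/-- Characteristic functions agree: the Gaussian Fourier integral at frequency `0` gives the
normaliser, at frequency `t` the numerator. -/
theorem stdGaussian_eq_tilted :
    stdGaussian E = (volume : Measure E).tilted fun x => -(1 / 2) * ‖x‖ ^ 2 := by
  have hint := integrable_exp_neg_mul_sq_norm (E := E) (b := 1 / 2) (by norm_num)
  have := isProbabilityMeasure_tilted hint
  refine Measure.ext_of_charFun ?_
  ext t
  rw [charFun_stdGaussian, charFun_apply, integral_tilted]
  have hb : (0 : ℝ) < ((1 / 2 : ℂ)).re := by norm_num
  have h₀ := GaussianFourier.integral_cexp_neg_mul_sq_norm_add (V := E) hb 0 0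
  have h₁ := GaussianFourier.integral_cexp_neg_mul_sq_norm_add (V := E) hb Complex.I t
  have hZ : ((∫ x : E, Real.exp (-(1 / 2) * ‖x‖ ^ 2) : ℝ) : ℂ) =
      ((Real.pi : ℂ) / (1 / 2)) ^ ((Module.finrank ℝ E : ℂ) / 2) := by
    rw [← integral_complex_ofReal]
    simp only [ne_eq, zero_mul, add_zero, OfNat.ofNat_ne_zero, not_false_eq_true, zero_pow,
      zero_div, Complex.exp_zero, mul_one] at h₀
    rw [← h₀]
    congr with x
    push_cast
    rfl
  have hZ₀ : ((∫ x : E, Real.exp (-(1 / 2) * ‖x‖ ^ 2) : ℝ) : ℂ) ≠ 0 :=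
    Complex.ofReal_ne_zero.2 (integral_exp_pos hint).ne'
  set Z := ∫ x : E, Real.exp (-(1 / 2) * ‖x‖ ^ 2)
  calc Complex.exp (-‖t‖ ^ 2 / 2)
      = (Z : ℂ)⁻¹ * ∫ x : E, Complex.exp (-(1 / 2) * ‖x‖ ^ 2 + Complex.I * (inner ℝ t x : ℝ)) := by
        rw [h₁, ← hZ, inv_mul_cancel_left₀ hZ₀, Complex.I_sq]
        ring_nf
    _ = _ := by
        rw [← integral_const_mul]
        congr with x
        rw [Complex.real_smul, Complex.exp_add, real_inner_comm]
        push_cast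
        ring_nf

variable {ι : Type*} [Fintype ι] [DecidableEq ι]

/-- The measure is the image of the standard Gaussian under `x ↦ m + T x` with `T = √S`. Since `T
S⁻¹ T = 1`, the exponent pulls back to `-½‖x‖²`, and Lebesgue measure is only rescaled. -/
theorem multivariateGaussian_eq_tilted (m : EuclideanSpace ℝ ι) {S : Matrix ι ι ℝ}
    (hS : S.PosDef) : multivariateGaussian m S = (volume : Measure (EuclideanSpace ℝ ι)).tilted
      fun x => -(1 / 2) * ((x - m).ofLp ⬝ᵥ S⁻¹ *ᵥ (x - m).ofLp) := by
  open scoped MatrixOrder in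
  set T := CFC.sqrt S with hT
  have hTT : T * T = S := by
    open scoped MatrixOrder in
    exact CFC.sqrt_mul_sqrt_self _ hS.posSemidef.nonneg
  have hTsymm : Tᵀ = T := by
    open scoped MatrixOrder in
    have h : IsSelfAdjoint T := (CFC.sqrt_nonneg S).isSelfAdjoint
    simpa [IsSelfAdjoint, star_eq_conjTranspose, conjTranspose_eq_transpose_of_trivial] using h
  have hdet : IsUnit T.det := by
    have h := hS.det_pos.ne'
    rw [← hTT, det_mul] at h
    exact (left_ne_zero_of_mul h).isUnit
  have hTST : T * S⁻¹ * T = 1 := by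
    rw [← hTT, Matrix.mul_inv_rev, ← Matrix.mul_assoc, Matrix.mul_nonsing_inv _ hdet,
      Matrix.one_mul, Matrix.nonsing_inv_mul _ hdet]
  set L := toEuclideanCLM (𝕜 := ℝ) T with hL
  have hLdet : LinearMap.det (L : EuclideanSpace ℝ ι →ₗ[ℝ] EuclideanSpace ℝ ι) ≠ 0 := by
    have h₁ : L * toEuclideanCLM (𝕜 := ℝ) T⁻¹ = 1 := by
      rw [hL, ← map_mul, Matrix.mul_nonsing_inv _ hdet, map_one]
    have h₂ : (L : EuclideanSpace ℝ ι →ₗ[ℝ] EuclideanSpace ℝ ι) *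
        ((toEuclideanCLM (𝕜 := ℝ) T⁻¹ : _ →L[ℝ] _) :
          EuclideanSpace ℝ ι →ₗ[ℝ] EuclideanSpace ℝ ι) = 1 := by
      ext1 x
      exact congrArg (fun f : EuclideanSpace ℝ ι →L[ℝ] EuclideanSpace ℝ ι => f x) h₁
    have h₃ := congrArg LinearMap.det h₂
    rw [map_mul, map_one] at h₃
    exact left_ne_zero_of_mul_eq_one h₃
  set f : EuclideanSpace ℝ ι → ℝ :=
    fun x => -(1 / 2) * ((x - m).ofLp ⬝ᵥ S⁻¹ *ᵥ (x - m).ofLp) with hf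
  have hfm : Measurable f := by
    refine Continuous.measurable ?_
    simp only [hf, dotProduct, mulVec]
    fun_prop
  have hcomp : (fun x : EuclideanSpace ℝ ι => -(1 / 2) * ‖x‖ ^ 2) = f ∘ fun x => m + L x := by
    ext x
    simp only [hf, Function.comp_apply, add_sub_cancel_left, hL, ofLp_toEuclideanCLM]
    rw [← real_inner_self_eq_norm_sq, mulVec_mulVec, ← vecMul_transpose, hTsymm,
      ← dotProduct_mulVec, mulVec_mulVec, ← Matrix.mul_assoc, hTST, one_mulVec,
      EuclideanSpace.inner_eq_star_dotProduct]
    simp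
  have hLm : Measurable (fun x => L x) := L.continuous.measurable
  rw [multivariateGaussian, stdGaussian_eq_tilted, hcomp, map_tilted_comp _ (by fun_prop) hfm]
  have hmap : (volume : Measure (EuclideanSpace ℝ ι)).map (fun x => m + L x) =
      ENNReal.ofReal |(LinearMap.det (L : EuclideanSpace ℝ ι →ₗ[ℝ] EuclideanSpace ℝ ι))⁻¹| •
        volume := by
    have h := Measure.map_linearMap_addHaar_eq_smul_addHaar
      (volume : Measure (EuclideanSpace ℝ ι)) hLdet
    rw [show (fun x => m + L x) = (fun x => m + x) ∘ (fun x => L x) from rfl,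
      ← Measure.map_map (by fun_prop) hLm]
    erw [h]
    rw [Measure.map_smul, map_add_left_eq_self]
  rw [hmap, smul_measure_tilted _ _ ENNReal.ofReal_ne_top]
  simpa using hLdet

end Gaussian

/-! ### Moments and quadratic forms -/

section QuadraticForm

variable {ι : Type*} [Fintype ι]

theorem integrable_dotProduct_const {q : Measure (EuclideanSpace ℝ ι)}
    (hq : Integrable (fun η => η) q) (u : ι → ℝ) : Integrable (fun η => η.ofLp ⬝ᵥ u) q := by
  refine (hq.inner_const (𝕜 := ℝ) (WithLp.toLp 2 u)).congr (ae_of_all _ fun η => ?_)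
  simp [EuclideanSpace.inner_eq_star_dotProduct, dotProduct_comm]

theorem integral_dotProduct_const {q : Measure (EuclideanSpace ℝ ι)}
    (hq : Integrable (fun η => η) q) (u : ι → ℝ) :
    ∫ η, η.ofLp ⬝ᵥ u ∂q = (∫ η, η ∂q).ofLp ⬝ᵥ u := by
  have h := integral_inner (𝕜 := ℝ) hq (WithLp.toLp 2 u)
  simpa [EuclideanSpace.inner_eq_star_dotProduct] using h

theorem integrable_quadraticForm {q : Measure (EuclideanSpace ℝ ι)}
    (hq : Integrable (fun η => ‖η‖ ^ 2) q) (B : Matrix ι ι ℝ) :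
    Integrable (fun η => η.ofLp ⬝ᵥ B *ᵥ η.ofLp) q := by
  have hm : MemLp (fun η : EuclideanSpace ℝ ι => η) 2 q :=
    (memLp_two_iff_integrable_sq_norm (by fun_prop)).2 hq
  have hc (i : ι) : MemLp (fun η : EuclideanSpace ℝ ι => η.ofLp i) 2 q :=
    hm.of_le (by fun_prop) (ae_of_all _ fun η => PiLp.norm_apply_le η i)
  simp only [dotProduct, mulVec]
  refine integrable_finsetSum _ fun i _ => (hc i).integrable_mul (q := 2) ?_
  exact memLp_finsetSum _ fun j _ => (hc j).const_mul _

/-- Completing the square. -/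
theorem dotProduct_mulVec_sub_self {S : Matrix ι ι ℝ} [DecidableEq ι] (hS : S.PosDef)
    (x a : ι → ℝ) :
    -(1 / 2) * ((x - S *ᵥ a) ⬝ᵥ S⁻¹ *ᵥ (x - S *ᵥ a)) =
      -(1 / 2) * (x ⬝ᵥ S⁻¹ *ᵥ x) + x ⬝ᵥ a - 1 / 2 * (a ⬝ᵥ S *ᵥ a) := by
  have hinv : S⁻¹ *ᵥ (S *ᵥ a) = a := by
    rw [mulVec_mulVec, Matrix.nonsing_inv_mul _ hS.det_pos.ne'.isUnit, one_mulVec]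
  have hsymm : (S *ᵥ a) ⬝ᵥ S⁻¹ *ᵥ x = x ⬝ᵥ a := by
    have hT : (S⁻¹)ᵀ = S⁻¹ := by
      simpa [conjTranspose_eq_transpose_of_trivial] using hS.inv.isHermitian.eq
    rw [dotProduct_mulVec, ← mulVec_transpose, hT, hinv, dotProduct_comm]
  rw [mulVec_sub, hinv, sub_dotProduct, dotProduct_sub, dotProduct_sub, hsymm,
    dotProduct_comm (S *ᵥ a) a]
  ring

end QuadraticForm

/-! ### The variational bound as a quadratic in `η` -/

namespace MedLDA

variable {D N K M : ℕ} (P : MedLDA D N K M)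

section Expectation

variable {E F : Type*} [AddCommGroup E] [Module ℝ E] [AddCommGroup F] [Module ℝ F]

theorem Ez_add (f g : (Fin D → Fin N → Fin K) → E) :
    P.Ez (fun z => f z + g z) = P.Ez f + P.Ez g := by
  simp [Ez, Finset.sum_add_distrib]

theorem map_Ez (l : E →ₗ[ℝ] F) (f : (Fin D → Fin N → Fin K) → E) :
    P.Ez (fun z => l (f z)) = l (P.Ez f) := by
  simp [Ez]

theorem Ez_sum {ι : Type*} (s : Finset ι) (f : ι → (Fin D → Fin N → Fin K) → E) :
    P.Ez (fun z => ∑ i ∈ s, f i z) = ∑ i ∈ s, P.Ez (f i) := by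
  simp only [Ez, Finset.smul_sum]
  exact Finset.sum_comm

end Expectation

theorem Ez_const_mul (c : ℝ) (f : (Fin D → Fin N → Fin K) → ℝ) :
    P.Ez (fun z => c * f z) = c * P.Ez f :=
  P.map_Ez (LinearMap.mulLeft ℝ c) f

theorem Ez_dotProduct_zbar (η : Fin K → ℝ) (d : Fin D) :
    P.Ez (fun z => η ⬝ᵥ zbar z d) = η ⬝ᵥ P.EZbar d :=
  P.map_Ez (dotProductBilin ℝ ℝ η) fun z => zbar z d

theorem Ez_quadraticForm (η : Fin K → ℝ) :
    P.Ez (fun z => η ⬝ᵥ ((A z)ᵀ * A z) *ᵥ η) = η ⬝ᵥ P.EAtA *ᵥ η :=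
  P.map_Ez ((dotProductBilin ℝ ℝ η).comp ((mulVecBilin ℝ ℝ).flip η)) fun z => (A z)ᵀ * A z

theorem dotProduct_gram_mulVec (η : Fin K → ℝ) (z : Fin D → Fin N → Fin K) :
    η ⬝ᵥ ((A z)ᵀ * A z) *ᵥ η = ∑ d, (η ⬝ᵥ zbar z d) ^ 2 := by
  rw [← mulVec_mulVec, dotProduct_mulVec, vecMul_transpose]
  simp only [dotProduct, sq, mulVec, A, of_apply, mul_comm]

theorem Ez_sum_sq (η : Fin K → ℝ) :
    ∑ d, P.Ez (fun z => (η ⬝ᵥ zbar z d) ^ 2) = η ⬝ᵥ P.EAtA *ᵥ η := by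
  rw [← P.Ez_sum, ← P.Ez_quadraticForm]
  simp only [dotProduct_gram_mulVec]

theorem posSemidef_EAtA : P.EAtA.PosSemidef := by
  have hw (z : Fin D → Fin N → Fin K) : 0 ≤ ∏ d, ∏ n, P.φ d n (z d n) :=
    Finset.prod_nonneg fun d _ => Finset.prod_nonneg fun n _ => (P.φ_mem d n).1 _
  refine posSemidef_sum _ fun z _ => PosSemidef.smul ?_ (hw z)
  simpa [conjTranspose_eq_transpose_of_trivial] using posSemidef_conjTranspose_mul_self (A z)

/-- The Hessian `E[Aᵀ A] / δ²` of the variational bound. -/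
def hessian : Matrix (Fin K) (Fin K) ℝ := (1 / (P.δ : ℝ) ^ 2) • P.EAtA

theorem posSemidef_hessian : P.hessian.PosSemidef := P.posSemidef_EAtA.smul (by positivity)

theorem posDef_one_add_hessian : (1 + P.hessian).PosDef :=
  PosDef.one.add_posSemidef P.posSemidef_hessian

theorem posDef_postCov : P.postCov.PosDef := P.posDef_one_add_hessian.inv

theorem postCov_inv : P.postCov⁻¹ = 1 + P.hessian :=
  Matrix.nonsing_inv_nonsing_inv _ P.posDef_one_add_hessian.det_pos.ne'.isUnit

theorem quadraticForm_hessian_nonneg (x : Fin K → ℝ) : 0 ≤ x ⬝ᵥ P.hessian *ᵥ x := by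
  simpa using P.posSemidef_hessian.dotProduct_mulVec_nonneg x

theorem quadraticForm_postCov_inv (x : EuclideanSpace ℝ (Fin K)) :
    x.ofLp ⬝ᵥ P.postCov⁻¹ *ᵥ x.ofLp = ‖x‖ ^ 2 + x.ofLp ⬝ᵥ P.hessian *ᵥ x.ofLp := by
  rw [postCov_inv, add_mulVec, one_mulVec, dotProduct_add, ← real_inner_self_eq_norm_sq,
    EuclideanSpace.inner_eq_star_dotProduct]
  simp

/-- Expanding around mean `0` leaves the normaliser untouched, so `Ls 0` can collect every term free
of `η`, Dirichlet integrals included, without evaluating it. -/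
theorem log_gaussianPDFReal {v : ℝ≥0} (m x : ℝ) (hv : v ≠ 0) :
    Real.log (gaussianPDFReal m v x) =
      Real.log (gaussianPDFReal 0 v x) - 1 / (2 * v) * m ^ 2 + x / v * m := by
  have hv' : (0 : ℝ) < v := by positivity
  have hc : (√(2 * Real.pi * v))⁻¹ ≠ 0 := by positivity
  rw [gaussianPDFReal, gaussianPDFReal, Real.log_mul hc (Real.exp_pos _).ne',
    Real.log_mul hc (Real.exp_pos _).ne', Real.log_exp, Real.log_exp]
  field_simp
  ring

/-- The variational bound is a convex quadratic function of the regression coefficients. -/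
theorem Ls_eq (η : EuclideanSpace ℝ (Fin K)) :
    P.Ls η = P.Ls 0 + 1 / 2 * (η.ofLp ⬝ᵥ P.hessian *ᵥ η.ofLp)
      - η.ofLp ⬝ᵥ ∑ d, (P.y d / (P.δ : ℝ) ^ 2) • P.EZbar d := by
  have hδ : (P.δ ^ 2 : ℝ≥0) ≠ 0 := pow_ne_zero 2 P.δ_pos.ne'
  have hterm (d : Fin D) :
      P.Ez (fun z => Real.log (gaussianPDFReal (η.ofLp ⬝ᵥ zbar z d) (P.δ ^ 2) (P.y d))) =
        P.Ez (fun z => Real.log (gaussianPDFReal ((0 : EuclideanSpace ℝ (Fin K)).ofLp ⬝ᵥ zbar z d)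
          (P.δ ^ 2) (P.y d))) + (-(1 / (2 * (P.δ : ℝ) ^ 2))
            * P.Ez (fun z => (η.ofLp ⬝ᵥ zbar z d) ^ 2)
          + P.y d / (P.δ : ℝ) ^ 2 * (η.ofLp ⬝ᵥ P.EZbar d)) := by
    rw [← P.Ez_dotProduct_zbar, ← P.Ez_const_mul, ← P.Ez_const_mul, ← P.Ez_add, ← P.Ez_add]
    congr with z
    rw [log_gaussianPDFReal _ _ hδ]
    simp only [WithLp.ofLp_zero, zero_dotProduct, NNReal.coe_pow]
    ring
  have hquad : η.ofLp ⬝ᵥ P.hessian *ᵥ η.ofLp =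
      1 / (P.δ : ℝ) ^ 2 * ∑ d, P.Ez (fun z => (η.ofLp ⬝ᵥ zbar z d) ^ 2) := by
    rw [hessian, smul_mulVec, dotProduct_smul, smul_eq_mul, Ez_sum_sq]
  have hlin : η.ofLp ⬝ᵥ ∑ d, (P.y d / (P.δ : ℝ) ^ 2) • P.EZbar d =
      ∑ d, P.y d / (P.δ : ℝ) ^ 2 * (η.ofLp ⬝ᵥ P.EZbar d) := by
    simp [dotProduct_sum]
  rw [hquad, hlin]
  simp only [Ls, expectedLogJoint, hterm, Finset.sum_add_distrib, ← Finset.mul_sum]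
  ring

theorem pred_eq {q : Measure (EuclideanSpace ℝ (Fin K))} (hq : Admissible q) (d : Fin D) :
    P.pred q d = (∫ η, η ∂q).ofLp ⬝ᵥ P.EZbar d := by
  simp only [pred, Ez_dotProduct_zbar]
  exact integral_dotProduct_const hq.2 _

theorem a_eq (μ μ' : Fin D → ℝ) :
    P.a μ μ' = ∑ d, (μ d - μ' d) • P.EZbar d + ∑ d, (P.y d / (P.δ : ℝ) ^ 2) • P.EZbar d := by
  simp only [a, add_smul, Finset.sum_add_distrib]

/-! ### The tilted prior and its normaliser -/

/-- The exponent by which the standard Gaussian is tilted in the optimal distribution. -/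
def exponent (u : Fin K → ℝ) (η : EuclideanSpace ℝ (Fin K)) : ℝ :=
  -(1 / 2) * (η.ofLp ⬝ᵥ P.hessian *ᵥ η.ofLp) + η.ofLp ⬝ᵥ u

theorem neg_half_sq_norm_add_exponent (u : Fin K → ℝ) (η : EuclideanSpace ℝ (Fin K)) :
    -(1 / 2) * ‖η‖ ^ 2 + P.exponent u η =
      -(1 / 2) * ((η - WithLp.toLp 2 (P.postCov *ᵥ u)).ofLp ⬝ᵥ
        P.postCov⁻¹ *ᵥ (η - WithLp.toLp 2 (P.postCov *ᵥ u)).ofLp)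
      + 1 / 2 * (u ⬝ᵥ P.postCov *ᵥ u) := by
  rw [WithLp.ofLp_sub, dotProduct_mulVec_sub_self P.posDef_postCov, quadraticForm_postCov_inv,
    exponent]
  ring

theorem integrable_exp_quadraticForm (m : EuclideanSpace ℝ (Fin K)) :
    Integrable fun η : EuclideanSpace ℝ (Fin K) =>
      Real.exp (-(1 / 2) * ((η - m).ofLp ⬝ᵥ P.postCov⁻¹ *ᵥ (η - m).ofLp)) := by
  have h₀ : Integrable fun η : EuclideanSpace ℝ (Fin K) =>
      Real.exp (-(1 / 2) * (η.ofLp ⬝ᵥ P.postCov⁻¹ *ᵥ η.ofLp)) := by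
    refine (integrable_exp_neg_mul_sq_norm (b := 1 / 2) (by norm_num)).mono' ?_
      (ae_of_all _ fun η => ?_)
    · refine Continuous.aestronglyMeasurable ?_
      simp only [dotProduct, mulVec]
      fun_prop
    · rw [Real.norm_of_nonneg (Real.exp_pos _).le, quadraticForm_postCov_inv]
      have := P.quadraticForm_hessian_nonneg η.ofLp
      exact Real.exp_le_exp.2 (by linarith)
  exact h₀.comp_sub_right m

theorem integrable_exp_exponent (u : Fin K → ℝ) :
    Integrable (fun η => Real.exp (P.exponent u η)) (stdGaussian (EuclideanSpace ℝ (Fin K))) := by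
  rw [stdGaussian_eq_tilted,
    integrable_tilted_iff (integrable_exp_neg_mul_sq_norm (b := 1 / 2) (by norm_num))]
  simp only [smul_eq_mul, ← Real.exp_add, neg_half_sq_norm_add_exponent]
  simp only [Real.exp_add]
  exact (P.integrable_exp_quadraticForm _).mul_const _

theorem tilted_exponent (u : Fin K → ℝ) :
    (stdGaussian (EuclideanSpace ℝ (Fin K))).tilted (P.exponent u) =
      multivariateGaussian (WithLp.toLp 2 (P.postCov *ᵥ u)) P.postCov := by
  have h : (fun η : EuclideanSpace ℝ (Fin K) => -(1 / 2) * ‖η‖ ^ 2) + P.exponent u = fun η => _ :=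
    funext (P.neg_half_sq_norm_add_exponent u)
  rw [stdGaussian_eq_tilted,
    tilted_tilted (integrable_exp_neg_mul_sq_norm (b := 1 / 2) (by norm_num)),
    multivariateGaussian_eq_tilted _ P.posDef_postCov, h, tilted_add_const]

theorem log_integral_exp_exponent (u : Fin K → ℝ) :
    Real.log (∫ η, Real.exp (P.exponent u η) ∂stdGaussian (EuclideanSpace ℝ (Fin K))) =
      Real.log (∫ η, Real.exp (P.exponent 0 η) ∂stdGaussian (EuclideanSpace ℝ (Fin K)))
        + 1 / 2 * (u ⬝ᵥ P.postCov *ᵥ u) := by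
  have key (u : Fin K → ℝ) :
      ∫ η, Real.exp (P.exponent u η) ∂stdGaussian (EuclideanSpace ℝ (Fin K)) =
        (∫ η : EuclideanSpace ℝ (Fin K),
            Real.exp (-(1 / 2) * (η.ofLp ⬝ᵥ P.postCov⁻¹ *ᵥ η.ofLp)))
          * Real.exp (1 / 2 * (u ⬝ᵥ P.postCov *ᵥ u))
          / ∫ η : EuclideanSpace ℝ (Fin K), Real.exp (-(1 / 2) * ‖η‖ ^ 2) := by
    rw [stdGaussian_eq_tilted, integral_exp_tilted]
    simp only [Pi.add_apply, neg_half_sq_norm_add_exponent]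
    simp only [Real.exp_add, integral_mul_const]
    -- Translation invariance: the Gaussian integral does not depend on its centre, hence not on
    -- `u`.
    rw [integral_sub_right_eq_self (fun η : EuclideanSpace ℝ (Fin K) =>
      Real.exp (-(1 / 2) * (η.ofLp ⬝ᵥ P.postCov⁻¹ *ᵥ η.ofLp)))]
  have hpos : 0 < ∫ η, Real.exp (P.exponent 0 η) ∂stdGaussian (EuclideanSpace ℝ (Fin K)) :=
    integral_exp_pos (P.integrable_exp_exponent 0)
  have h : ∫ η, Real.exp (P.exponent u η) ∂stdGaussian (EuclideanSpace ℝ (Fin K)) =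
      (∫ η, Real.exp (P.exponent 0 η) ∂stdGaussian (EuclideanSpace ℝ (Fin K)))
        * Real.exp (1 / 2 * (u ⬝ᵥ P.postCov *ᵥ u)) := by
    rw [key, key 0]
    simp only [zero_dotProduct, mul_zero, Real.exp_zero]
    ring
  rw [h, Real.log_mul hpos.ne' (Real.exp_pos _).ne', Real.log_exp]

/-- Makes `Ls` integrable under every `q` of finite divergence. The factor `1 / 4` could be any
positive number below the Gaussian's `1 / 2`. -/
theorem integrable_sq_norm_of_klDiv_ne_top {q : Measure (EuclideanSpace ℝ (Fin K))}
    [IsProbabilityMeasure q]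
    (h : InformationTheory.klDiv q (stdGaussian (EuclideanSpace ℝ (Fin K))) ≠ ∞) :
    Integrable (fun η => ‖η‖ ^ 2) q := by
  have hint : Integrable (fun η => Real.exp (1 / 4 * ‖η‖ ^ 2))
      (stdGaussian (EuclideanSpace ℝ (Fin K))) := by
    rw [stdGaussian_eq_tilted,
      integrable_tilted_iff (integrable_exp_neg_mul_sq_norm (b := 1 / 2) (by norm_num))]
    refine (integrable_exp_neg_mul_sq_norm (b := 1 / 4) (by norm_num)).congr
      (ae_of_all _ fun η => ?_)
    simp only [smul_eq_mul, ← Real.exp_add]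
    ring_nf
  have h₄ := (integrable_of_klDiv_ne_top h (by fun_prop) (fun η => by positivity) hint).const_mul 4
  refine h₄.congr (ae_of_all _ fun η => ?_)
  ring

theorem integrable_exponent {q : Measure (EuclideanSpace ℝ (Fin K))}
    (hq : Integrable (fun η => η) q) (hq₂ : Integrable (fun η => ‖η‖ ^ 2) q) (u : Fin K → ℝ) :
    Integrable (P.exponent u) q :=
  ((integrable_quadraticForm hq₂ _).const_mul _).add (integrable_dotProduct_const hq u)

/-! ### The Lagrangian as a divergence from the posterior -/

/-- The optimal distribution. -/
def posterior (μ μ' : Fin D → ℝ) : Measure (EuclideanSpace ℝ (Fin K)) :=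
  multivariateGaussian (P.postMean μ μ') P.postCov

theorem posterior_eq_tilted (μ μ' : Fin D → ℝ) : P.posterior μ μ' =
    (stdGaussian (EuclideanSpace ℝ (Fin K))).tilted (P.exponent (P.a μ μ')) :=
  (P.tilted_exponent _).symm

instance isGaussian_posterior (μ μ' : Fin D → ℝ) : IsGaussian (P.posterior μ μ') :=
  isGaussian_multivariateGaussian

theorem admissible_posterior (μ μ' : Fin D → ℝ) : Admissible (P.posterior μ μ') :=
  ⟨inferInstance, IsGaussian.integrable_fun_id⟩

theorem pred_posterior (μ μ' : Fin D → ℝ) (d : Fin D) :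
    P.pred (P.posterior μ μ') d = P.EZbar d ⬝ᵥ P.postCov *ᵥ P.a μ μ' := by
  rw [P.pred_eq (P.admissible_posterior μ μ'), posterior, integral_id_multivariateGaussian,
    dotProduct_comm]
  rfl

theorem klDiv_posterior_ne_top (μ μ' : Fin D → ℝ) : InformationTheory.klDiv (P.posterior μ μ')
    (stdGaussian (EuclideanSpace ℝ (Fin K))) ≠ ∞ := by
  have hsq : Integrable (fun η => ‖η‖ ^ 2) (P.posterior μ μ') :=
    (memLp_two_iff_integrable_sq_norm (by fun_prop)).1 IsGaussian.memLp_two_id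
  have h := P.integrable_exponent (P.admissible_posterior μ μ').2 hsq (P.a μ μ')
  rw [posterior_eq_tilted] at h ⊢
  exact klDiv_tilted_left_ne_top (P.integrable_exp_exponent _) h

/-- The constant by which the dual function differs from the quadratic objective. -/
def dualConst : ℝ := P.Ls 0
  - Real.log (∫ η, Real.exp (P.exponent 0 η) ∂stdGaussian (EuclideanSpace ℝ (Fin K)))

/-- The part of the Lagrangian that depends on the slack variables. -/
def slackTerm (ξ ξ' μ μ' v v' : Fin D → ℝ) : ℝ :=
  ∑ d, (ξ d * (P.C - (μ d + v d)) + ξ' d * (P.C - (μ' d + v' d)))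

/-- All other terms are real, the Bochner integral of `Ls` included, whether or not `Ls` is
integrable. -/
theorem lagrangian_of_klDiv_eq_top {q : Measure (EuclideanSpace ℝ (Fin K))}
    (h : InformationTheory.klDiv q (stdGaussian (EuclideanSpace ℝ (Fin K))) = ∞)
    (ξ ξ' μ μ' v v' : Fin D → ℝ) : P.lagrangian (stdGaussian _) q ξ ξ' μ μ' v v' = ⊤ := by
  simp only [lagrangian, objective, Lbs, h, EReal.coe_ennreal_top, EReal.top_add_coe]

/-- The Lagrangian is, up to terms that do not depend on `q`, the divergence of `q` from the
optimal distribution. -/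
theorem lagrangian_of_klDiv_ne_top {q : Measure (EuclideanSpace ℝ (Fin K))} (hq : Admissible q)
    (h : InformationTheory.klDiv q (stdGaussian (EuclideanSpace ℝ (Fin K))) ≠ ∞)
    (ξ ξ' μ μ' v v' : Fin D → ℝ) :
    InformationTheory.klDiv q (P.posterior μ μ') ≠ ∞ ∧
      P.lagrangian (stdGaussian _) q ξ ξ' μ μ' v v' =
        (((InformationTheory.klDiv q (P.posterior μ μ')).toReal
          + (P.dualConst + P.qpObjective μ μ' + P.slackTerm ξ ξ' μ μ' v v') : ℝ) : EReal) := by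
  have := hq.1
  have hsq := integrable_sq_norm_of_klDiv_ne_top h
  obtain ⟨hne, hkl⟩ := klDiv_tilted_right h (P.integrable_exponent hq.2 hsq (P.a μ μ'))
    (P.integrable_exp_exponent (P.a μ μ'))
  rw [← posterior_eq_tilted] at hne hkl
  refine ⟨hne, ?_⟩
  have hLs : ∫ η, P.Ls η ∂q = P.Ls 0 - ∫ η, P.exponent (P.a μ μ') η ∂q
      + ∑ d, (μ d - μ' d) * P.pred q d := by
    have hpt (η : EuclideanSpace ℝ (Fin K)) : P.Ls η = P.Ls 0 - P.exponent (P.a μ μ') η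
        + η.ofLp ⬝ᵥ ∑ d, (μ d - μ' d) • P.EZbar d := by
      rw [Ls_eq, exponent, a_eq, dotProduct_add]
      ring
    rw [integral_congr_ae (ae_of_all _ hpt)]
    have hi := P.integrable_exponent hq.2 hsq (P.a μ μ')
    have hi' : Integrable (fun η => P.Ls 0 - P.exponent (P.a μ μ') η) q :=
      (integrable_const _).sub hi
    rw [integral_add hi' (integrable_dotProduct_const hq.2 _), integral_sub (integrable_const _) hi, integral_dotProduct_const hq.2, dotProduct_sum]
    simp [P.pred_eq hq]
  have hE : ((InformationTheory.klDiv q (stdGaussian (EuclideanSpace ℝ (Fin K))) : ℝ≥0∞) : EReal)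
      = ((InformationTheory.klDiv q (stdGaussian (EuclideanSpace ℝ (Fin K)))).toReal : ℝ) :=
    (EReal.coe_ennreal_toReal h).symm
  simp only [lagrangian, objective, Lbs, hE, ← EReal.coe_add]
  rw [EReal.coe_eq_coe_iff, hkl, hLs, log_integral_exp_exponent, dualConst, qpObjective, slackTerm]
  -- The predictions in the constraint terms cancel those left over in `hLs`; what remains is linear
  -- in the multipliers and slacks.
  have hsum : P.C * ∑ d, (ξ d + ξ' d) + (-(∑ d, μ d * (P.ε + ξ d - P.y d + P.pred q d))
      - (∑ d, μ' d * (P.ε + ξ' d + P.y d - P.pred q d)) - ∑ d, (v d * ξ d + v' d * ξ' d))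
      + ∑ d, (μ d - μ' d) * P.pred q d =
      -(P.ε * ∑ d, (μ d + μ' d)) + ∑ d, P.y d * (μ d - μ' d)
        + ∑ d, (ξ d * (P.C - (μ d + v d)) + ξ' d * (P.C - (μ' d + v' d))) := by
    simp only [Finset.mul_sum, ← Finset.sum_neg_distrib, ← Finset.sum_sub_distrib,
      ← Finset.sum_add_distrib]
    exact Finset.sum_congr rfl fun d _ => by ring
  linarith

theorem le_lagrangian {q : Measure (EuclideanSpace ℝ (Fin K))} (hq : Admissible q)
    (ξ ξ' μ μ' v v' : Fin D → ℝ) :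
    ((P.dualConst + P.qpObjective μ μ' + P.slackTerm ξ ξ' μ μ' v v' : ℝ) : EReal) ≤
      P.lagrangian (stdGaussian _) q ξ ξ' μ μ' v v' := by
  by_cases h : InformationTheory.klDiv q (stdGaussian (EuclideanSpace ℝ (Fin K))) = ∞
  · simp [P.lagrangian_of_klDiv_eq_top h]
  · rw [(P.lagrangian_of_klDiv_ne_top hq h ξ ξ' μ μ' v v').2, EReal.coe_le_coe_iff]
    exact le_add_of_nonneg_left ENNReal.toReal_nonneg

theorem lagrangian_posterior (ξ ξ' μ μ' v v' : Fin D → ℝ) :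
    P.lagrangian (stdGaussian _) (P.posterior μ μ') ξ ξ' μ μ' v v' =
      ((P.dualConst + P.qpObjective μ μ' + P.slackTerm ξ ξ' μ μ' v v' : ℝ) : EReal) := by
  rw [(P.lagrangian_of_klDiv_ne_top (P.admissible_posterior μ μ')
    (P.klDiv_posterior_ne_top μ μ') ξ ξ' μ μ' v v').2, InformationTheory.klDiv_self]
  simp

theorem eq_posterior_of_lagrangian_le {q : Measure (EuclideanSpace ℝ (Fin K))} (hq : Admissible q)
    {ξ ξ' μ μ' v v' : Fin D → ℝ} (hle : P.lagrangian (stdGaussian _) q ξ ξ' μ μ' v v' ≤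
      ((P.dualConst + P.qpObjective μ μ' + P.slackTerm ξ ξ' μ μ' v v' : ℝ) : EReal)) :
    q = P.posterior μ μ' := by
  have := hq.1
  by_cases h : InformationTheory.klDiv q (stdGaussian (EuclideanSpace ℝ (Fin K))) = ∞
  · rw [P.lagrangian_of_klDiv_eq_top h, top_le_iff] at hle
    exact absurd hle (EReal.coe_ne_top _)
  · obtain ⟨hne, heq⟩ := P.lagrangian_of_klDiv_ne_top hq h ξ ξ' μ μ' v v'
    rw [heq, EReal.coe_le_coe_iff, add_le_iff_nonpos_left] at hle
    rw [← InformationTheory.klDiv_eq_zero_iff]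
    have h₀ := le_antisymm hle ENNReal.toReal_nonneg
    exact ((ENNReal.toReal_eq_zero_iff _).1 h₀).resolve_right hne

end MedLDA

/-! ### The dual function and the quadratic program -/

namespace MedLDA

variable {D N K M : ℕ} (P : MedLDA D N K M)

theorem slackTerm_eq_zero {μ μ' v v' : Fin D → ℝ}
    (h : ∀ d, μ d + v d = P.C ∧ μ' d + v' d = P.C) (ξ ξ' : Fin D → ℝ) :
    P.slackTerm ξ ξ' μ μ' v v' = 0 := by
  simp [slackTerm, h]

/-- One slack coordinate with nonzero coefficient reaches every real value, as the Lagrangian leaves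
the slacks free in sign. -/
theorem exists_slackTerm_eq {μ μ' v v' : Fin D → ℝ}
    (h : ¬ ∀ d, μ d + v d = P.C ∧ μ' d + v' d = P.C) (t : ℝ) :
    ∃ ξ ξ', P.slackTerm ξ ξ' μ μ' v v' = t := by
  simp only [not_forall, not_and_or] at h
  obtain ⟨d, h | h⟩ := h
  · have h₀ : P.C - (μ d + v d) ≠ 0 := sub_ne_zero.2 (Ne.symm h)
    refine ⟨Pi.single d (t / (P.C - (μ d + v d))), 0, ?_⟩
    simp [slackTerm, Pi.single_apply, h₀]
  · have h₀ : P.C - (μ' d + v' d) ≠ 0 := sub_ne_zero.2 (Ne.symm h)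
    refine ⟨0, Pi.single d (t / (P.C - (μ' d + v' d))), ?_⟩
    simp [slackTerm, Pi.single_apply, h₀]

theorem dualFun_le (μ μ' v v' ξ ξ' : Fin D → ℝ) : P.dualFun (stdGaussian _) μ μ' v v' ≤
    ((P.dualConst + P.qpObjective μ μ' + P.slackTerm ξ ξ' μ μ' v v' : ℝ) : EReal) := by
  rw [← lagrangian_posterior]
  refine (iInf₂_le (P.posterior μ μ') (P.admissible_posterior μ μ')).trans ?_
  exact (iInf_le _ ξ).trans (iInf_le _ ξ')

theorem dualFun_eq (μ μ' v v' : Fin D → ℝ) : P.dualFun (stdGaussian _) μ μ' v v' =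
    if ∀ d, μ d + v d = P.C ∧ μ' d + v' d = P.C
      then ((P.dualConst + P.qpObjective μ μ' : ℝ) : EReal) else ⊥ := by
  split_ifs with h
  · refine le_antisymm ?_ (le_iInf₂ fun q hq => le_iInf₂ fun ξ ξ' => ?_)
    · simpa [P.slackTerm_eq_zero h] using P.dualFun_le μ μ' v v' 0 0
    · simpa [P.slackTerm_eq_zero h] using P.le_lagrangian hq ξ ξ' μ μ' v v'
  · rw [EReal.eq_bot_iff_forall_lt]
    intro r
    obtain ⟨ξ, ξ', hξ⟩ := P.exists_slackTerm_eq h (r - 1 - (P.dualConst + P.qpObjective μ μ'))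
    refine (P.dualFun_le μ μ' v v' ξ ξ').trans_lt (EReal.coe_lt_coe_iff.2 ?_)
    linarith

theorem dualFun_of_add_eq {μ μ' v v' : Fin D → ℝ}
    (h : ∀ d, μ d + v d = P.C ∧ μ' d + v' d = P.C) : P.dualFun (stdGaussian _) μ μ' v v' =
      ((P.dualConst + P.qpObjective μ μ' : ℝ) : EReal) := by
  rw [dualFun_eq, if_pos h]

theorem inBox_zero : P.InBox 0 0 := fun _ => by simp [P.C_pos.le]

theorem isDualSolution_iff (μ μ' : Fin D → ℝ) :
    P.IsDualSolution (stdGaussian _) μ μ' ↔ P.IsQPSolution μ μ' := by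
  have hbox {μ₁ μ₁' : Fin D → ℝ} (h : P.InBox μ₁ μ₁') (v₁ v₁' : Fin D → ℝ)
      (hv : v₁ = fun d => P.C - μ₁ d) (hv' : v₁' = fun d => P.C - μ₁' d) :
      (0 ≤ μ₁ ∧ 0 ≤ μ₁' ∧ 0 ≤ v₁ ∧ 0 ≤ v₁') ∧ P.dualFun (stdGaussian _) μ₁ μ₁' v₁ v₁' =
        ((P.dualConst + P.qpObjective μ₁ μ₁' : ℝ) : EReal) := by
    subst hv hv'
    exact ⟨⟨fun d => (h d).1.1, fun d => (h d).2.1, fun d => sub_nonneg.2 (h d).1.2,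
      fun d => sub_nonneg.2 (h d).2.2⟩, P.dualFun_of_add_eq fun d => by simp⟩
  constructor
  · rintro ⟨v, v', ⟨h₁, h₂, h₃, h₄⟩, hmax⟩
    have hge {μ₁ μ₁' : Fin D → ℝ} (h : P.InBox μ₁ μ₁') :
        ((P.dualConst + P.qpObjective μ₁ μ₁' : ℝ) : EReal) ≤
          P.dualFun (stdGaussian _) μ μ' v v' := by
      obtain ⟨⟨g₁, g₂, g₃, g₄⟩, g⟩ := hbox h _ _ rfl rfl
      exact g ▸ hmax _ _ _ _ g₁ g₂ g₃ g₄
    -- The origin of the box has finite dual value, so a maximiser cannot have value `⊥`.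
    have hC : ∀ d, μ d + v d = P.C ∧ μ' d + v' d = P.C := by
      by_contra hC
      have h := hge P.inBox_zero
      rw [dualFun_eq, if_neg hC, le_bot_iff] at h
      exact EReal.coe_ne_bot _ h
    refine ⟨fun d => ⟨⟨h₁ d, ?_⟩, ⟨h₂ d, ?_⟩⟩, fun μ₁ μ₁' h => ?_⟩
    · have := h₃ d
      have := (hC d).1
      simp only [Pi.zero_apply] at *
      linarith
    · have := h₄ d
      have := (hC d).2
      simp only [Pi.zero_apply] at *
      linarith
    · have h := hge h
      rw [P.dualFun_of_add_eq hC, EReal.coe_le_coe_iff] at h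
      linarith
  · rintro ⟨hb, hmax⟩
    obtain ⟨hpos, heq⟩ := hbox hb _ _ rfl rfl
    refine ⟨_, _, hpos, fun μ₁ μ₁' v₁ v₁' g₁ g₂ g₃ g₄ => ?_⟩
    rw [heq, dualFun_eq]
    split_ifs with hC
    · rw [EReal.coe_le_coe_iff]
      have h : P.InBox μ₁ μ₁' := fun d => by
        have k₁ := g₁ d
        have k₂ := g₂ d
        have k₃ := g₃ d
        have k₄ := g₄ d
        have k₅ := hC d
        simp only [Pi.zero_apply] at k₁ k₂ k₃ k₄
        exact ⟨⟨k₁, by linarith⟩, ⟨k₂, by linarith⟩⟩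
      linarith [hmax _ _ h]
    · exact bot_le

theorem exists_isQPSolution : ∃ μ μ' : Fin D → ℝ, P.IsQPSolution μ μ' := by
  have hcomp : IsCompact ((Set.univ.pi fun _ : Fin D => Set.Icc (0 : ℝ) P.C) ×ˢ
      (Set.univ.pi fun _ : Fin D => Set.Icc (0 : ℝ) P.C)) :=
    (isCompact_univ_pi fun _ => isCompact_Icc).prod (isCompact_univ_pi fun _ => isCompact_Icc)
  have hne : ((Set.univ.pi fun _ : Fin D => Set.Icc (0 : ℝ) P.C) ×ˢ
      (Set.univ.pi fun _ : Fin D => Set.Icc (0 : ℝ) P.C)).Nonempty :=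
    ⟨(0, 0), fun _ _ => by simp [P.C_pos.le], fun _ _ => by simp [P.C_pos.le]⟩
  have hcont : Continuous fun p : (Fin D → ℝ) × (Fin D → ℝ) => P.qpObjective p.1 p.2 := by
    simp only [qpObjective, a, dotProduct, mulVec, Finset.sum_apply, Pi.smul_apply, smul_eq_mul]
    fun_prop
  obtain ⟨⟨μ, μ'⟩, hmem, hmax⟩ := hcomp.exists_isMaxOn hne hcont.continuousOn
  refine ⟨μ, μ', fun d => ⟨hmem.1 d trivial, hmem.2 d trivial⟩, fun μ₁ μ₁' h => ?_⟩
  exact hmax (a := (μ₁, μ₁')) ⟨fun d _ => (h d).1, fun d _ => (h d).2⟩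

/-! ### First-order conditions of the quadratic program -/

theorem dotProduct_postCov_comm (x y : Fin K → ℝ) :
    x ⬝ᵥ P.postCov *ᵥ y = y ⬝ᵥ P.postCov *ᵥ x := by
  have hT : P.postCovᵀ = P.postCov := by
    simpa [conjTranspose_eq_transpose_of_trivial] using P.posDef_postCov.isHermitian.eq
  rw [dotProduct_mulVec, ← mulVec_transpose, hT, dotProduct_comm]

theorem a_add_single (μ μ' : Fin D → ℝ) (d : Fin D) (t t' : ℝ) :
    P.a (μ + Pi.single d t) (μ' + Pi.single d t') = P.a μ μ' + (t - t') • P.EZbar d := by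
  have h (i : Fin D) : ((μ + (Pi.single d t : Fin D → ℝ)) i - (μ' + (Pi.single d t' : Fin D → ℝ)) i + P.y i / (P.δ : ℝ) ^ 2)
      • P.EZbar i = (μ i - μ' i + P.y i / (P.δ : ℝ) ^ 2) • P.EZbar i
        + (if i = d then (t - t') • P.EZbar i else 0) := by
    by_cases hi : i = d
    · subst hi
      simp only [Pi.add_apply, Pi.single_eq_same, if_true, ← add_smul]
      congr 1
      ring
    · simp [hi]
  simp only [a, h, Finset.sum_add_distrib, Finset.sum_ite_eq', Finset.mem_univ, if_true]

/-- Exact second-order expansion. Since `Σa` is the posterior mean, the partial derivatives are the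
residuals of the posterior predictions less `ε`. -/
theorem qpObjective_add_single (μ μ' : Fin D → ℝ) (d : Fin D) (t t' : ℝ) :
    P.qpObjective (μ + Pi.single d t) (μ' + Pi.single d t') = P.qpObjective μ μ'
      + (t * (P.y d - P.pred (P.posterior μ μ') d - P.ε)
        + t' * (-P.y d + P.pred (P.posterior μ μ') d - P.ε))
      - 1 / 2 * (t - t') ^ 2 * (P.EZbar d ⬝ᵥ P.postCov *ᵥ P.EZbar d) := by
  have h₁ : ∑ i, ((μ + (Pi.single d t : Fin D → ℝ)) i + (μ' + (Pi.single d t' : Fin D → ℝ)) i) =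
      ∑ i, (μ i + μ' i) + (t + t') := by
    simp only [Pi.add_apply, Finset.sum_add_distrib, Finset.sum_pi_single', Finset.mem_univ,
      if_true]
    ring
  have h₂ : ∑ i, P.y i * ((μ + (Pi.single d t : Fin D → ℝ)) i - (μ' + (Pi.single d t' : Fin D → ℝ)) i) =
      ∑ i, P.y i * (μ i - μ' i) + P.y d * (t - t') := by
    simp only [Pi.add_apply, mul_sub, mul_add, Finset.sum_add_distrib, Finset.sum_sub_distrib,
      Pi.single_apply, mul_ite, mul_zero, Finset.sum_ite_eq', Finset.mem_univ, if_true]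
    ring
  rw [qpObjective, a_add_single, h₁, h₂, pred_posterior, qpObjective, mulVec_add, mulVec_smul,
    add_dotProduct, dotProduct_add, dotProduct_add, smul_dotProduct, smul_dotProduct,
    dotProduct_smul, dotProduct_smul, P.dotProduct_postCov_comm (P.a μ μ') (P.EZbar d)]
  simp only [smul_eq_mul]
  ring

/-- A quadratic with a nonpositive increment on `[0, 1]` has nonpositive slope at `0`. -/
theorem nonpos_of_forall_mul_sub_sq_le {g c : ℝ}
    (h : ∀ s ∈ Set.Icc (0 : ℝ) 1, s * g - s ^ 2 * c ≤ 0) : g ≤ 0 := by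
  by_contra! hg
  have hc : 0 < |c| + g := by positivity
  -- With this `s`, `s * c ≤ g / 2 < g`, so the increment `s * (g - s * c)` would be positive.
  have hs₀ : 0 < g / (2 * (|c| + g)) := by positivity
  have hs₁ : g / (2 * (|c| + g)) ≤ 1 := by
    rw [div_le_one (by positivity)]
    linarith [abs_nonneg c]
  have key := h _ ⟨hs₀.le, hs₁⟩
  set s := g / (2 * (|c| + g)) with hs
  have h₁ : s * (|c| + g) = g / 2 := by rw [hs]; field_simp
  have h₂ : s * c ≤ s * (|c| + g) := by
    refine mul_le_mul_of_nonneg_left ?_ hs₀.le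
    linarith [le_abs_self c]
  have h₃ : 0 < s * (g - s * c) := mul_pos hs₀ (by linarith)
  linarith [show s * (g - s * c) = s * g - s ^ 2 * c by ring]

variable {P}

/-- First-order optimality conditions of the quadratic program. -/
theorem IsQPSolution.deriv_nonpos {μ μ' : Fin D → ℝ} (h : P.IsQPSolution μ μ') (d : Fin D)
    {t t' : ℝ} (ht : t ∈ Set.Icc 0 P.C) (ht' : t' ∈ Set.Icc 0 P.C) :
    (t - μ d) * (P.y d - P.pred (P.posterior μ μ') d - P.ε)
      + (t' - μ' d) * (-P.y d + P.pred (P.posterior μ μ') d - P.ε) ≤ 0 := by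
  refine nonpos_of_forall_mul_sub_sq_le (c := 1 / 2 * ((t - μ d) - (t' - μ' d)) ^ 2
    * (P.EZbar d ⬝ᵥ P.postCov *ᵥ P.EZbar d)) fun s hs => ?_
  have hconv {x y : ℝ} (hx : x ∈ Set.Icc 0 P.C) (hy : y ∈ Set.Icc 0 P.C) :
      x + s * (y - x) ∈ Set.Icc 0 P.C := by
    have := (convex_Icc (0 : ℝ) P.C) hx hy (sub_nonneg.2 hs.2) hs.1 (by ring)
    convert this using 1
    simp only [smul_eq_mul]
    ring
  have hbox : P.InBox (μ + Pi.single d (s * (t - μ d))) (μ' + Pi.single d (s * (t' - μ' d))) := by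
    intro i
    by_cases hi : i = d
    · subst hi
      simpa using ⟨hconv (h.1 i).1 ht, hconv (h.1 i).2 ht'⟩
    · simpa [hi] using h.1 i
  have hle := h.2 _ _ hbox
  rw [qpObjective_add_single] at hle
  linarith

/-- Complementary slackness for one multiplier constrained to an interval. -/
theorem complementary_slackness {m C g : ℝ} (hm : m ∈ Set.Icc 0 C)
    (h : ∀ t ∈ Set.Icc 0 C, (t - m) * g ≤ 0) :
    m * (max g 0 - g) = 0 ∧ (C - m) * max g 0 = 0 := by
  -- The two endpoints suffice: `(C - m) * g ≤ 0` and `0 ≤ m * g`.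
  have hC := h C ⟨hm.1.trans hm.2, le_rfl⟩
  have h0 := h 0 ⟨le_rfl, hm.1.trans hm.2⟩
  have hC' := mul_nonneg (sub_nonneg.2 hm.2) (le_max_right g 0)
  rcases le_total g 0 with hg | hg
  · rw [max_eq_right hg]
    exact ⟨by nlinarith [hm.1], mul_zero _⟩
  · rw [max_eq_left hg] at *
    exact ⟨by simp, le_antisymm hC hC'⟩

/-! ### Weak and strong duality -/

variable (P)

theorem lagrangian_le_objective {q : Measure (EuclideanSpace ℝ (Fin K))} {ξ ξ' : Fin D → ℝ}
    (p₀ : Measure (EuclideanSpace ℝ (Fin K))) (h : P.Feasible q ξ ξ') {μ μ' v v' : Fin D → ℝ}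
    (hμ : 0 ≤ μ) (hμ' : 0 ≤ μ') (hv : 0 ≤ v) (hv' : 0 ≤ v') :
    P.lagrangian p₀ q ξ ξ' μ μ' v v' ≤ P.objective p₀ q ξ ξ' := by
  have h₁ : 0 ≤ ∑ d, μ d * (P.ε + ξ d - P.y d + P.pred q d) :=
    Finset.sum_nonneg fun d _ => mul_nonneg (hμ d) (by linarith [(h.2 d).1])
  have h₂ : 0 ≤ ∑ d, μ' d * (P.ε + ξ' d + P.y d - P.pred q d) :=
    Finset.sum_nonneg fun d _ => mul_nonneg (hμ' d) (by linarith [(h.2 d).2.1])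
  have h₃ : 0 ≤ ∑ d, (v d * ξ d + v' d * ξ' d) :=
    Finset.sum_nonneg fun d _ => add_nonneg (mul_nonneg (hv d) (h.2 d).2.2.1)
      (mul_nonneg (hv' d) (h.2 d).2.2.2)
  calc P.lagrangian p₀ q ξ ξ' μ μ' v v' ≤ P.objective p₀ q ξ ξ' + ((0 : ℝ) : EReal) :=
        add_le_add_right (EReal.coe_le_coe_iff.2 (by linarith)) _
    _ = P.objective p₀ q ξ ξ' := by simp

variable {P}

/-- Strong duality: at a solution of the dual problem the optimal distribution attains the dual
value. -/
theorem IsQPSolution.exists_feasible {μ μ' : Fin D → ℝ} (h : P.IsQPSolution μ μ') :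
    ∃ ξ ξ', P.Feasible (P.posterior μ μ') ξ ξ' ∧
      P.objective (stdGaussian _) (P.posterior μ μ') ξ ξ' =
        ((P.dualConst + P.qpObjective μ μ' : ℝ) : EReal) := by
  set p := P.pred (P.posterior μ μ') with hp
  have hg (d : Fin D) := complementary_slackness (g := P.y d - p d - P.ε) (h.1 d).1 fun t ht => by
    simpa using h.deriv_nonpos d ht (h.1 d).2
  have hg' (d : Fin D) := complementary_slackness (g := -P.y d + p d - P.ε) (h.1 d).2
    fun t ht => by simpa using h.deriv_nonpos d (h.1 d).1 ht
  -- The least slacks that the posterior predictions allow.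
  refine ⟨fun d => max (P.y d - p d - P.ε) 0, fun d => max (-P.y d + p d - P.ε) 0,
    ⟨P.admissible_posterior μ μ', fun d => ⟨?_, ?_, le_max_right _ _, le_max_right _ _⟩⟩, ?_⟩
  · linarith [le_max_left (P.y d - p d - P.ε) 0]
  · linarith [le_max_left (-P.y d + p d - P.ε) 0]
  · have hL := P.lagrangian_posterior (fun d => max (P.y d - p d - P.ε) 0)
      (fun d => max (-P.y d + p d - P.ε) 0) μ μ' (fun d => P.C - μ d) (fun d => P.C - μ' d)
    rw [P.slackTerm_eq_zero (fun d => by simp), add_zero] at hL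
    rw [← hL, lagrangian, ← hp]
    have h₁ : ∑ d, μ d * (P.ε + max (P.y d - p d - P.ε) 0 - P.y d + p d) = 0 :=
      Finset.sum_eq_zero fun d _ => Eq.trans (by ring) (hg d).1
    have h₂ : ∑ d, μ' d * (P.ε + max (-P.y d + p d - P.ε) 0 + P.y d - p d) = 0 :=
      Finset.sum_eq_zero fun d _ => Eq.trans (by ring) (hg' d).1
    simp only [h₁, h₂, (hg _).2, (hg' _).2]
    simp

/-- For an optimal `q`, Lagrangian ≤ objective ≤ objective of the posterior = dual value; but the
dual value is the minimum of the Lagrangian, attained only at the posterior. -/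
theorem IsQPSolution.isOptimal_iff {μ μ' : Fin D → ℝ} (h : P.IsQPSolution μ μ')
    (q : Measure (EuclideanSpace ℝ (Fin K))) :
    (∃ ξ ξ', P.IsOptimal (stdGaussian _) q ξ ξ') ↔ q = P.posterior μ μ' := by
  obtain ⟨ξ₀, ξ₀', hfeas, hval⟩ := h.exists_feasible
  have hC : ∀ d, μ d + (P.C - μ d) = P.C ∧ μ' d + (P.C - μ' d) = P.C := fun d => by simp
  have hweak {q : Measure (EuclideanSpace ℝ (Fin K))} {ξ ξ' : Fin D → ℝ}
      (hq : P.Feasible q ξ ξ') := P.lagrangian_le_objective (stdGaussian _) hq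
        (μ := μ) (μ' := μ') (v := fun d => P.C - μ d) (v' := fun d => P.C - μ' d)
        (fun d => (h.1 d).1.1) (fun d => (h.1 d).2.1) (fun d => sub_nonneg.2 (h.1 d).1.2)
        (fun d => sub_nonneg.2 (h.1 d).2.2)
  constructor
  · rintro ⟨ξ, ξ', hq, hopt⟩
    refine P.eq_posterior_of_lagrangian_le hq.1 (ξ := ξ) (ξ' := ξ') (v := fun d => P.C - μ d)
      (v' := fun d => P.C - μ' d) ?_
    rw [P.slackTerm_eq_zero hC, add_zero, ← hval]
    exact (hweak hq).trans (hopt _ _ _ hfeas)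
  · rintro rfl
    refine ⟨ξ₀, ξ₀', hfeas, fun q₁ ξ₁ ξ₁' hq₁ => ?_⟩
    have hle := P.le_lagrangian hq₁.1 ξ₁ ξ₁' μ μ' (fun d => P.C - μ d) (fun d => P.C - μ' d)
    rw [P.slackTerm_eq_zero hC, add_zero, ← hval] at hle
    exact hle.trans (hweak hq₁)

variable (P)

theorem isMin_lagrangian_iff (ξ ξ' μ μ' v v' : Fin D → ℝ)
    (q : Measure (EuclideanSpace ℝ (Fin K))) :
    (Admissible q ∧ ∀ q₁, Admissible q₁ → P.lagrangian (stdGaussian _) q ξ ξ' μ μ' v v' ≤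
        P.lagrangian (stdGaussian _) q₁ ξ ξ' μ μ' v v') ↔ q = P.posterior μ μ' := by
  constructor
  · rintro ⟨hq, hmin⟩
    refine P.eq_posterior_of_lagrangian_le hq (v := v) (v' := v') (ξ := ξ) (ξ' := ξ') ?_
    rw [← lagrangian_posterior]
    exact hmin _ (P.admissible_posterior μ μ')
  · rintro rfl
    refine ⟨P.admissible_posterior μ μ', fun q₁ hq₁ => ?_⟩
    rw [lagrangian_posterior]
    exact P.le_lagrangian hq₁ ξ ξ' μ μ' v v'

end MedLDA
end

theorem corollary2 {D N K M : ℕ} (hN : 0 < N) (P : MedLDA D N K M)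
    (p₀ : Measure (EuclideanSpace ℝ (Fin K))) (hp₀ : p₀ = multivariateGaussian 0 1) :
    -- the covariance matrix is a genuine (positive definite) one
    P.postCov.PosDef ∧
    -- for given multipliers, the unique minimiser of the Lagrangian in `q(η)` is `N(λ, Σ)`
    (∀ (ξ ξ' μ μ' v v' : Fin D → ℝ) (q : Measure (EuclideanSpace ℝ (Fin K))),
      (MedLDA.Admissible q ∧ ∀ q₁, MedLDA.Admissible q₁ →
          P.lagrangian p₀ q ξ ξ' μ μ' v v' ≤ P.lagrangian p₀ q₁ ξ ξ' μ μ' v v') ↔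
        q = multivariateGaussian (P.postMean μ μ') P.postCov) ∧
    -- the dual function is the quadratic objective up to an additive constant
    (∃ c : ℝ, ∀ μ μ' v v' : Fin D → ℝ,
      P.dualFun p₀ μ μ' v v' =
        if ∀ d, μ d + v d = P.C ∧ μ' d + v' d = P.C
        then ((c + P.qpObjective μ μ' : ℝ) : EReal) else ⊥) ∧
    -- the dual problem is the quadratic program over the box, and it is solvable
    (∀ μ μ' : Fin D → ℝ, P.IsDualSolution p₀ μ μ' ↔ P.IsQPSolution μ μ') ∧
    (∃ μ μ' : Fin D → ℝ, P.IsDualSolution p₀ μ μ') ∧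
    -- the optimal `q(η)` of the primal problem exists, is unique, and is `N(λ, Σ)`
    (∀ μ μ' : Fin D → ℝ, P.IsDualSolution p₀ μ μ' →
      ∀ q : Measure (EuclideanSpace ℝ (Fin K)),
        (∃ ξ ξ' : Fin D → ℝ, P.IsOptimal p₀ q ξ ξ') ↔
          q = multivariateGaussian (P.postMean μ μ') P.postCov) := by
  rw [multivariateGaussian_zero_one] at hp₀
  subst hp₀
  refine ⟨P.posDef_postCov, P.isMin_lagrangian_iff, ⟨P.dualConst, P.dualFun_eq⟩,
    P.isDualSolution_iff, ?_, fun μ μ' h => ((P.isDualSolution_iff μ μ').1 h).isOptimal_iff⟩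
  obtain ⟨μ, μ', h⟩ := P.exists_isQPSolution
  exact ⟨μ, μ', (P.isDualSolution_iff μ μ').2 h⟩
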